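/- Let $d\ge 1$ and let $R=(R_{ijk})_{1\le i,j,k\le d}$ be real numbers such that (T) $R_{ijk}\ge 0$ for all $i,j,k$; (B) there is $\sigma\in(0,\infty)$ with $\sum_{i=1}^d R_{ijk}=\sigma$ for all $j,k$; (E) $\max_{1\le j,j',k,k'\le d}\sum_{i=1}^d |R_{ijk}-R_{ij'k'}|<\sigma$. For $x,y\in\mathbb R^d$ let $\mathcal R(x,y)\in\mathbb R^d$ be given by $\mathcal R_k(x,y)=\sum_{i,j=1}^d R_{kij}x_iy_j$, and let $\Delta_d=\{x\in[0,1]^d:\|x\|_1=1\}$. A 2-drawing $d$-colour Pólya urn with replacement tensor $R$ is a stochastic process $(U(n))_{n\ge0}$ with values in $[0,\infty)^d$ such that $U_i(n+1)=U_i(n)+R(i,C_1(n),C_2(n))$ for all $n\ge 0$ and $1\le i\le d$, where $R(i,j,k)=R_{ijk}$ and, given $U(0),\dots,U(n)$, the colours $C_1(n),C_2(n)\in\{1,\dots,d\}$ are independent and each of them equals $k$ with probability $U_k(n)/\sum_{i=1}^d U_i(n)$, whenever $\sum_{i=1}^d U_i(n)>0$. Then (i) there exists a unique $x^*\in\Delta_d$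 such that $\sigma x^*=\mathcal R(x^*,x^*)$; and (ii) for every 2-drawing $d$-colour Pólya urn $(U(n))_{n\ge0}$ with replacement tensor $R$ and $\|U(0)\|_1>0$ almost surely, $U(n)/\|U(n)\|_1\to x^*$ in probability as $n\to\infty$. -/

import Mathlib

open MeasureTheory ProbabilityTheory Filter

noncomputable section

namespace PolyaUrn

/-- The `ℓ¹`-norm of a vector of `ℝ^d`. -/
def l1norm {d : ℕ} (x : Fin d → ℝ) : ℝ := ∑ i, |x i|

/-- The bilinear map `ℝ^d × ℝ^d → ℝ^d` given by a `3`-mode tensor `R = (R i j k)`: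
`(tensorMap R x y)_k = ∑_{i,j} R_{k i j} x_i y_j`. -/
def tensorMap {d : ℕ} (R : Fin d → Fin d → Fin d → ℝ) (x y : Fin d → ℝ) : Fin d → ℝ :=
  fun k => ∑ i, ∑ j, R k i j * x i * y j

/-- Tenability: all entries of the replacement tensor are non-negative. -/
def Tenable {d : ℕ} (R : Fin d → Fin d → Fin d → ℝ) : Prop :=
  ∀ i j k, 0 ≤ R i j k

/-- Balance with constant `σ ∈ (0, ∞)`: every draw adds the total mass `σ`. -/
def Balanced {d : ℕ} (R : Fin d → Fin d → Fin d → ℝ) (σ : ℝ) : Prop :=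
  0 < σ ∧ ∀ j k, ∑ i, R i j k = σ

/-- The ergodicity condition: the (finite) maximum over `j, j', k, k'` of
`∑ i, |R i j k - R i j' k'|` is less than `σ`. -/
def Ergodic {d : ℕ} (R : Fin d → Fin d → Fin d → ℝ) (σ : ℝ) : Prop :=
  ∀ j j' k k', ∑ i, |R i j k - R i j' k'| < σ

/-- `U` is a `2`-drawing `d`-colour Pólya urn with replacement tensor `R`, where `C₁ n` and `C₂ n`
are the two colours drawn (in this order) at time `n`. The composition is a vector of non-negative
reals. Given `U 0, …, U n`, the two draws are independent and each has colour `k` with probability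
`U n k / ∑ i, U n i`; this is required where the urn is not empty. -/
structure IsTwoDrawUrn {d : ℕ} (R : Fin d → Fin d → Fin d → ℝ) {Ω : Type*} [MeasurableSpace Ω]
    (μ : Measure Ω) (U : ℕ → Ω → Fin d → ℝ) (C₁ C₂ : ℕ → Ω → Fin d) : Prop where
  measurable_U : ∀ n, Measurable (U n)
  measurable_C₁ : ∀ n, Measurable (C₁ n)
  measurable_C₂ : ∀ n, Measurable (C₂ n)
  nonneg_init : ∀ᵐ ω ∂μ, ∀ i, 0 ≤ U 0 ω i
  step : ∀ n, ∀ᵐ ω ∂μ, ∀ i, U (n + 1) ω i = U n ω i + R i (C₁ n ω) (C₂ n ω)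
  draw : ∀ n j k, ∀ᵐ ω ∂μ, 0 < ∑ i, U n ω i →
    (μ⟦{ω' | C₁ n ω' = j ∧ C₂ n ω' = k} |
        Filtration.natural U (fun m => (measurable_U m).stronglyMeasurable) n⟧) ω
      = (U n ω j / ∑ i, U n ω i) * (U n ω k / ∑ i, U n ω i)

end PolyaUrn

end

/-! The quadratic map `T x = tensorMap R x x` is a strict contraction after division by `σ`.
Dobrushin's argument shrinks zero-sum vectors by `r/2`, where `r < σ` bounds the distances between
columns, and `x ↦ x ⊗ x` expands `ℓ¹`-distances on the simplex by at most 2; hence `T` is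
`r`-Lipschitz there (`sum_abs_tensorMap_sub_le`). This gives the unique fixed point `x` of `σ⁻¹ T`.

For the urn, write `U n = A n + M n`, where `A` (`compensator`) accumulates the conditional mean
increments `T (share (U k))` and `M` (`noise`) has bounded, conditionally centred increments.
Orthogonality gives `E |M n i| = O(√n)`. Let `S n` be the mass and `D n = ‖A n - S n • x‖₁`
(`drift`). Since `S` grows by `σ` and `σ • x = T x`, the contraction yields `D (n+1) ≤ D n + r/(σ n)
(D n + ‖M n‖₁)`. In mean, as `r/σ < 1` and the noise is `O(√n)`, this forces `E D n = o(n)`.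
Markov's inequality concludes. As `U 0` need not be integrable, the drift is averaged only where the
initial mass is bounded. -/

namespace PolyaUrn

/-! ### Contraction of the quadratic map -/

/-- Dobrushin's contraction estimate for a finite family of vectors whose pairwise
`ℓ¹`-distances are at most `r`. -/
theorem two_mul_sum_abs_sum_mul_le {α ι : Type*} [Fintype α] [Fintype ι] {f : α → ι → ℝ} {r : ℝ}
    (hf : ∀ p p', ∑ i, |f i p - f i p'| ≤ r) {q : ι → ℝ} (hq : ∑ p, q p = 0) :
    2 * ∑ i, |∑ p, f i p * q p| ≤ r * ∑ p, |q p| := by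
  set a : ι → ℝ := fun p => max (q p) 0 with ha
  set b : ι → ℝ := fun p => max (-q p) 0 with hb
  have ha0 : ∀ p, 0 ≤ a p := fun p => le_max_right _ _
  have hb0 : ∀ p, 0 ≤ b p := fun p => le_max_right _ _
  have hab : ∀ p, q p = a p - b p := by
    intro p
    rcases le_total 0 (q p) with h | h <;> simp [ha, hb, h]
  have habs : ∀ p, |q p| = a p + b p := by
    intro p
    rcases le_total 0 (q p) with h | h <;> simp [ha, hb, h, abs_of_nonneg, abs_of_nonpos]
  set m := ∑ p, a p with hm
  have hbm : ∑ p, b p = m := by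
    simp only [hab, Finset.sum_sub_distrib] at hq
    linarith
  have hsum : ∑ p, |q p| = 2 * m := by
    simp only [habs, Finset.sum_add_distrib, hbm]; ring
  have hm0 : 0 ≤ m := Finset.sum_nonneg fun p _ => ha0 p
  -- The positive and negative parts of `q` have equal mass `m`; coupling them by the product
  -- weights `a p * b p'` leaves only differences of `f`.
  have key : ∀ i, m * ∑ p, f i p * q p = ∑ p, ∑ p', (f i p - f i p') * (a p * b p') := by
    intro i
    have h1 : ∑ p, ∑ p', f i p * (a p * b p') = (∑ p, f i p * a p) * m := by
      rw [← hbm, Finset.sum_mul_sum]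
      simp only [mul_assoc]
    have h2 : ∑ p, ∑ p', f i p' * (a p * b p') = m * ∑ p, f i p * b p := by
      rw [hm, Finset.sum_mul_sum]
      refine Finset.sum_congr rfl fun p _ => Finset.sum_congr rfl fun p' _ => by ring
    simp only [sub_mul, Finset.sum_sub_distrib, h1, h2]
    simp only [hab, mul_sub, Finset.sum_sub_distrib]
    ring
  rcases hm0.eq_or_lt with h0 | hpos
  · have hz : ∀ p, q p = 0 := by
      have : ∑ p, |q p| = 0 := by rw [hsum, ← h0]; ring
      intro p
      exact abs_eq_zero.1
        ((Finset.sum_eq_zero_iff_of_nonneg fun p _ => abs_nonneg (q p)).1 this p (Finset.mem_univ p))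
    simp [hz]
  have hmain : m * ∑ i, |∑ p, f i p * q p| ≤ m * (r * m) := by
    calc m * ∑ i, |∑ p, f i p * q p| = ∑ i, |∑ p, ∑ p', (f i p - f i p') * (a p * b p')| := by
          rw [Finset.mul_sum]
          refine Finset.sum_congr rfl fun i _ => ?_
          rw [← key, abs_mul, abs_of_pos hpos]
      _ ≤ ∑ i, ∑ p, ∑ p', |f i p - f i p'| * (a p * b p') := by
          refine Finset.sum_le_sum fun i _ => (Finset.abs_sum_le_sum_abs _ _).trans ?_
          refine Finset.sum_le_sum fun p _ => (Finset.abs_sum_le_sum_abs _ _).trans ?_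
          refine Finset.sum_le_sum fun p' _ => ?_
          rw [abs_mul, abs_of_nonneg (mul_nonneg (ha0 p) (hb0 p'))]
      _ = ∑ p, ∑ p', (∑ i, |f i p - f i p'|) * (a p * b p') := by
          rw [Finset.sum_comm]
          refine Finset.sum_congr rfl fun p _ => ?_
          rw [Finset.sum_comm]
          refine Finset.sum_congr rfl fun p' _ => ?_
          rw [Finset.sum_mul]
      _ ≤ ∑ p, ∑ p', r * (a p * b p') :=
          Finset.sum_le_sum fun p _ => Finset.sum_le_sum fun p' _ =>
            mul_le_mul_of_nonneg_right (hf p p') (mul_nonneg (ha0 p) (hb0 p'))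
      _ = m * (r * m) := by
          simp only [← Finset.mul_sum, ← Finset.sum_mul, hbm, ← hm]; ring
  have := le_of_mul_le_mul_left hmain hpos
  rw [hsum]; linarith

variable {d : ℕ} {R : Fin d → Fin d → Fin d → ℝ} {σ r : ℝ}

/-- Telescope `x ⊗ x - y ⊗ y = x ⊗ (x - y) + (x - y) ⊗ y`. The factor 2 cancels the one in
Dobrushin's estimate. -/
theorem sum_sum_abs_mul_sub_mul_le {x y : Fin d → ℝ} (hx : x ∈ stdSimplex ℝ (Fin d))
    (hy : y ∈ stdSimplex ℝ (Fin d)) :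
    ∑ i, ∑ j, |x i * x j - y i * y j| ≤ 2 * ∑ i, |x i - y i| := by
  calc ∑ i, ∑ j, |x i * x j - y i * y j|
      ≤ ∑ i, ∑ j, (x i * |x j - y j| + |x i - y i| * y j) := by
        refine Finset.sum_le_sum fun i _ => Finset.sum_le_sum fun j _ => ?_
        calc |x i * x j - y i * y j| = |x i * (x j - y j) + (x i - y i) * y j| := by ring_nf
          _ ≤ _ := (abs_add_le _ _).trans_eq (by
            rw [abs_mul, abs_mul, abs_of_nonneg (hx.1 i), abs_of_nonneg (hy.1 j)])
    _ = 2 * ∑ i, |x i - y i| := by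
        simp only [Finset.sum_add_distrib, ← Finset.mul_sum, ← Finset.sum_mul, hx.2, hy.2]; ring

/-- The quadratic map of a balanced tensor is Lipschitz in `ℓ¹` on the simplex, with constant the
largest `ℓ¹`-distance of two columns. -/
theorem sum_abs_tensorMap_sub_le (hr : ∀ j j' k k', ∑ i, |R i j k - R i j' k'| ≤ r)
    {x y : Fin d → ℝ} (hx : x ∈ stdSimplex ℝ (Fin d)) (hy : y ∈ stdSimplex ℝ (Fin d)) (h0 : 0 ≤ r) :
    ∑ i, |tensorMap R x x i - tensorMap R y y i| ≤ r * ∑ i, |x i - y i| := by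
  have h := two_mul_sum_abs_sum_mul_le (α := Fin d) (ι := Fin d × Fin d)
    (f := fun i p => R i p.1 p.2) (r := r) (fun p p' => hr p.1 p'.1 p.2 p'.2)
    (q := fun p => x p.1 * x p.2 - y p.1 * y p.2) (by
      rw [Fintype.sum_prod_type]
      simp only [Finset.sum_sub_distrib, ← Finset.mul_sum, ← Finset.sum_mul, hx.2, hy.2]
      ring)
  simp only [Fintype.sum_prod_type] at h
  have hT : ∀ i, tensorMap R x x i - tensorMap R y y i =
      ∑ j, ∑ k, R i j k * (x j * x k - y j * y k) := by
    intro i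
    simp only [tensorMap, ← Finset.sum_sub_distrib]
    refine Finset.sum_congr rfl fun p _ => Finset.sum_congr rfl fun p' _ => by ring
  simp only [hT]
  have := mul_le_mul_of_nonneg_left (sum_sum_abs_mul_sub_mul_le hx hy) h0
  linarith

theorem le_of_balanced (hT : Tenable R) (hB : Balanced R σ) (i j k : Fin d) : R i j k ≤ σ := by
  rw [← hB.2 j k]
  exact Finset.single_le_sum (f := fun i => R i j k) (fun i _ => hT i j k) (Finset.mem_univ i)

theorem tensorMap_nonneg (hT : Tenable R) {x : Fin d → ℝ} (hx : ∀ i, 0 ≤ x i) (i : Fin d) :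
    0 ≤ tensorMap R x x i :=
  Finset.sum_nonneg fun j _ => Finset.sum_nonneg fun k _ =>
    mul_nonneg (mul_nonneg (hT i j k) (hx j)) (hx k)

theorem sum_tensorMap (hB : Balanced R σ) {x : Fin d → ℝ} (hx : ∑ i, x i = 1) :
    ∑ i, tensorMap R x x i = σ := by
  simp only [tensorMap]
  rw [Finset.sum_comm]
  have : ∀ j, ∑ i, ∑ k, R i j k * x j * x k = σ * x j := by
    intro j
    rw [Finset.sum_comm]
    simp only [← Finset.sum_mul, hB.2, ← Finset.mul_sum, hx, mul_one]
  simp only [this, ← Finset.mul_sum, hx, mul_one]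

theorem tensorMap_le (hT : Tenable R) (hB : Balanced R σ) {x : Fin d → ℝ}
    (hx : x ∈ stdSimplex ℝ (Fin d)) (i : Fin d) : tensorMap R x x i ≤ σ := by
  rw [← sum_tensorMap hB hx.2]
  exact Finset.single_le_sum (fun i _ => tensorMap_nonneg hT hx.1 i) (Finset.mem_univ i)

/-- Finitely many strict inequalities leave a uniform gap, which is the contraction margin. -/
theorem Ergodic.exists_lt (hE : Ergodic R σ) (hσ : 0 < σ) :
    ∃ r, 0 ≤ r ∧ r < σ ∧ ∀ j j' k k', ∑ i, |R i j k - R i j' k'| ≤ r := by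
  rcases isEmpty_or_nonempty (Fin d) with he | hne
  · exact ⟨0, le_rfl, hσ, fun j => he.elim j⟩
  obtain ⟨p, hp⟩ := Finite.exists_max
    (fun p : Fin d × Fin d × Fin d × Fin d => ∑ i, |R i p.1 p.2.2.1 - R i p.2.1 p.2.2.2|)
  exact ⟨_, Finset.sum_nonneg fun _ _ => abs_nonneg _, hE _ _ _ _,
    fun j j' k k' => hp (j, j', k, k')⟩

/-! ### The fixed point -/

theorem eq_of_fixed (hr0 : 0 ≤ r) (hrσ : r < σ)
    (hr : ∀ j j' k k', ∑ i, |R i j k - R i j' k'| ≤ r) {x y : Fin d → ℝ}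
    (hx : x ∈ stdSimplex ℝ (Fin d)) (hy : y ∈ stdSimplex ℝ (Fin d))
    (hxf : σ • x = tensorMap R x x) (hyf : σ • y = tensorMap R y y) : y = x := by
  have h := sum_abs_tensorMap_sub_le hr hy hx hr0
  simp only [← hxf, ← hyf, Pi.smul_apply, smul_eq_mul, ← mul_sub, abs_mul, ← Finset.mul_sum,
    abs_of_pos (hr0.trans_lt hrσ)] at h
  have h0 : 0 ≤ ∑ i, |y i - x i| := Finset.sum_nonneg fun _ _ => abs_nonneg _
  have hz : ∑ i, |y i - x i| = 0 := by nlinarith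
  funext i
  exact sub_eq_zero.1 (abs_eq_zero.1
    ((Finset.sum_eq_zero_iff_of_nonneg fun p _ => abs_nonneg (y p - x p)).1 hz i (Finset.mem_univ i)))

/-- By compactness some point of the simplex minimises the displacement `‖T x - σ x‖₁`; moving it to
`σ⁻¹ T x` would shrink a nonzero displacement by the factor `r/σ`. -/
theorem exists_fixed (hd : 1 ≤ d) (hT : Tenable R) (hB : Balanced R σ) (hr0 : 0 ≤ r) (hrσ : r < σ)
    (hr : ∀ j j' k k', ∑ i, |R i j k - R i j' k'| ≤ r) :
    ∃ x ∈ stdSimplex ℝ (Fin d), σ • x = tensorMap R x x := by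
  have hσ := hB.1
  have : Nonempty (Fin d) := ⟨⟨0, hd⟩⟩
  have hne : (stdSimplex ℝ (Fin d)).Nonempty := ⟨_, single_mem_stdSimplex ℝ (Classical.arbitrary _)⟩
  obtain ⟨x, hx, hmin⟩ := (isCompact_stdSimplex ℝ (Fin d)).exists_isMinOn hne
    (f := fun x => ∑ i, |tensorMap R x x i - σ * x i|) (by
      unfold tensorMap; fun_prop)
  refine ⟨x, hx, ?_⟩
  set y : Fin d → ℝ := fun i => σ⁻¹ * tensorMap R x x i with hy
  have hσy : ∀ i, σ * y i = tensorMap R x x i := fun i => by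
    rw [hy]; field_simp
  have hys : y ∈ stdSimplex ℝ (Fin d) := by
    refine ⟨fun i => mul_nonneg (inv_nonneg.2 hσ.le) (tensorMap_nonneg hT hx.1 i), ?_⟩
    rw [← Finset.mul_sum, sum_tensorMap hB hx.2, inv_mul_cancel₀ hσ.ne']
  have h1 : ∑ i, |tensorMap R x x i - σ * x i| ≤ ∑ i, |tensorMap R y y i - σ * y i| := hmin hys
  have h2 := sum_abs_tensorMap_sub_le hr hys hx hr0
  have h3 : ∑ i, |tensorMap R x x i - σ * x i| = σ * ∑ i, |y i - x i| := by
    rw [Finset.mul_sum]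
    refine Finset.sum_congr rfl fun i _ => ?_
    rw [← hσy, ← mul_sub, abs_mul, abs_of_pos hσ]
  simp only [hσy] at h1
  rw [h3] at h1
  have h0 : 0 ≤ ∑ i, |y i - x i| := Finset.sum_nonneg fun _ _ => abs_nonneg _
  have hz : ∑ i, |y i - x i| = 0 := by nlinarith
  funext i
  have hi : y i = x i := sub_eq_zero.1 (abs_eq_zero.1
    ((Finset.sum_eq_zero_iff_of_nonneg fun p _ => abs_nonneg (y p - x p)).1 hz i (Finset.mem_univ i)))
  rw [Pi.smul_apply, smul_eq_mul, ← hi, hσy]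

/-! ### Deterministic recursions -/

/-- A nonnegative sequence with `u (n + 1) ≤ (1 - c n) * u n + c n * δ n`, where `∑ c = ∞` and
`δ → 0`, tends to zero. -/
theorem tendsto_zero_of_le_sub_mul {u c δ : ℕ → ℝ} (hu : ∀ n, 0 ≤ u n) (hc0 : ∀ n, 0 ≤ c n)
    (hc1 : ∀ n, c n ≤ 1) (hc : ¬ Summable c) (hδ : Tendsto δ atTop (nhds 0))
    (h : ∀ᶠ n in atTop, u (n + 1) ≤ u n - c n * (u n - δ n)) : Tendsto u atTop (nhds 0) := by
  refine Metric.tendsto_atTop.2 fun ε hε => ?_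
  obtain ⟨N, hN⟩ := eventually_atTop.1 (h.and (hδ.eventually (gt_mem_nhds (half_pos (half_pos hε)))))
  -- While `u n > ε/2` and `δ n < ε/4`, each step loses at least `c n * (ε/4)`; divergence of `∑ c`
  -- would make `u` negative.
  have hex : ∃ n, N ≤ n ∧ u n ≤ ε / 2 := by
    by_contra! hcon
    refine hc ((summable_nat_add_iff N).1 ?_)
    refine summable_of_sum_range_le (c := u N / (ε / 4)) (fun n => hc0 _) fun n => ?_
    have : ∀ n, (∑ i ∈ Finset.range n, c (i + N)) * (ε / 4) ≤ u N - u (n + N) := by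
      intro n
      induction n with
      | zero => simp
      | succ n ih =>
        rw [Finset.sum_range_succ]
        have h1 := hN (n + N) (by omega)
        have h2 := hcon (n + N) (by omega)
        have h3 : c (n + N) * (ε / 4) ≤ c (n + N) * (u (n + N) - δ (n + N)) :=
          mul_le_mul_of_nonneg_left (by linarith [h1.2]) (hc0 _)
        have h4 : u (n + 1 + N) = u (n + N + 1) := by congr 1; omega
        rw [h4]
        linarith [h1.1]
    rw [le_div_iff₀ (by positivity)]
    linarith [this n, hu (n + N)]
  obtain ⟨n, hn, hun⟩ := hex
  refine ⟨n, fun m hm => ?_⟩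
  -- The level `ε/2` is never left again: since `c ≤ 1`, the next value is at most a convex
  -- combination of `u m` and `δ m`.
  suffices u m ≤ ε / 2 by
    rw [Real.dist_eq, sub_zero, abs_of_nonneg (hu m)]; linarith
  induction m, hm using Nat.le_induction with
  | base => exact hun
  | succ m hm ih =>
    have h1 := hN m (by omega)
    nlinarith [h1.1, h1.2, hc0 m, hc1 m]

/-- Division by `n + 1` turns growth at rate `κ/n` into decay of `e n / n` at rate `(1 - κ)/(n +
1)`, whose sum diverges, with forcing of order `1/√n`. -/
theorem tendsto_div_atTop_of_le {e : ℕ → ℝ} {κ C : ℝ} (he : ∀ n, 0 ≤ e n) (hκ0 : 0 ≤ κ)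
    (hκ : κ < 1) (h : ∀ n : ℕ, 1 ≤ n → e (n + 1) ≤ (1 + κ / n) * e n + C * √n / n) :
    Tendsto (fun n : ℕ => e n / n) atTop (nhds 0) := by
  have hκ' : 0 < 1 - κ := by linarith
  refine tendsto_zero_of_le_sub_mul (c := fun n : ℕ => (1 - κ) * (1 / ((n : ℝ) + 1)))
    (δ := fun n : ℕ => C / (1 - κ) * (√(n : ℝ))⁻¹)
    (fun n => div_nonneg (he n) n.cast_nonneg) (fun n => by positivity) (fun n => ?_) ?_ ?_ ?_
  · have : 1 / ((n : ℝ) + 1) ≤ 1 := by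
      rw [div_le_one (by positivity)]; linarith [(n.cast_nonneg : (0 : ℝ) ≤ n)]
    have h0 : 0 ≤ 1 / ((n : ℝ) + 1) := by positivity
    nlinarith
  · rw [summable_mul_left_iff hκ'.ne']
    intro hs
    refine Real.not_summable_one_div_natCast ((summable_nat_add_iff 1).1 ?_)
    simpa using hs
  · rw [← mul_zero (C / (1 - κ))]
    exact (tendsto_inv_atTop_zero.comp
      (Real.tendsto_sqrt_atTop.comp tendsto_natCast_atTop_atTop)).const_mul _
  · filter_upwards [eventually_ge_atTop 1] with n hn
    have hn0 : (0 : ℝ) < n := by exact_mod_cast hn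
    have hs : 0 < √(n : ℝ) := Real.sqrt_pos.2 hn0
    have hss : (n : ℝ) = √(n : ℝ) * √(n : ℝ) := (Real.mul_self_sqrt hn0.le).symm
    have h1 := h n hn
    push_cast
    rw [div_le_iff₀ (by positivity)]
    refine h1.trans_eq ?_
    have hinv : (√(n : ℝ))⁻¹ = √(n : ℝ) / n := by
      rw [eq_div_iff hn0.ne', inv_mul_eq_div, div_eq_iff hs.ne']; exact hss
    rw [hinv]
    field_simp
    ring

end PolyaUrn

/-! ### Decomposition along a path -/

namespace PolyaUrn

variable {d : ℕ} {R : Fin d → Fin d → Fin d → ℝ} {σ r : ℝ}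

/-- The proportions of the colours in an urn with composition `u`. -/
noncomputable def share (u : Fin d → ℝ) : Fin d → ℝ := fun j => u j / ∑ i, u i

/-- The predictable part of an urn path. -/
noncomputable def compensator (R : Fin d → Fin d → Fin d → ℝ) (u : ℕ → Fin d → ℝ) (n : ℕ) : Fin d → ℝ :=
  fun i => u 0 i + ∑ k ∈ Finset.range n, tensorMap R (share (u k)) (share (u k)) i

/-- The martingale part of an urn path. -/
noncomputable def noise (R : Fin d → Fin d → Fin d → ℝ) (u : ℕ → Fin d → ℝ) (n : ℕ) : Fin d → ℝ :=
  fun i => u n i - compensator R u n i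

/-- The `ℓ¹`-distance of the predictable part from the multiple of `x` with the mass of the urn. -/
noncomputable def drift (R : Fin d → Fin d → Fin d → ℝ) (x : Fin d → ℝ) (u : ℕ → Fin d → ℝ) (n : ℕ) : ℝ :=
  ∑ i, |compensator R u n i - (∑ j, u n j) * x i|

/-- A deterministic path of the urn, with drawn colours `c₁` and `c₂`. -/
structure IsPath (R : Fin d → Fin d → Fin d → ℝ) (u : ℕ → Fin d → ℝ) (c₁ c₂ : ℕ → Fin d) :
    Prop where
  nonneg_init : ∀ i, 0 ≤ u 0 i
  pos_init : 0 < ∑ i, u 0 i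
  step : ∀ n i, u (n + 1) i = u n i + R i (c₁ n) (c₂ n)

namespace IsPath

variable {u : ℕ → Fin d → ℝ} {c₁ c₂ : ℕ → Fin d}

theorem nonneg (h : IsPath R u c₁ c₂) (hT : Tenable R) (n : ℕ) (i : Fin d) : 0 ≤ u n i := by
  induction n with
  | zero => exact h.nonneg_init i
  | succ n ih => rw [h.step]; exact add_nonneg ih (hT _ _ _)

theorem sum_eq (h : IsPath R u c₁ c₂) (hB : Balanced R σ) (n : ℕ) :
    ∑ i, u n i = ∑ i, u 0 i + n * σ := by
  induction n with
  | zero => simp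
  | succ n ih =>
    simp only [h.step n, Finset.sum_add_distrib, ih, hB.2]
    push_cast; ring

theorem sum_pos (h : IsPath R u c₁ c₂) (hB : Balanced R σ) (n : ℕ) : 0 < ∑ i, u n i := by
  rw [h.sum_eq hB]
  have := h.pos_init
  have := hB.1
  positivity

theorem mul_le_sum (h : IsPath R u c₁ c₂) (hB : Balanced R σ) (n : ℕ) : n * σ ≤ ∑ i, u n i := by
  rw [h.sum_eq hB]; linarith [h.pos_init]

theorem share_mem (h : IsPath R u c₁ c₂) (hT : Tenable R) (hB : Balanced R σ) (n : ℕ) :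
    share (u n) ∈ stdSimplex ℝ (Fin d) := by
  refine ⟨fun i => div_nonneg (h.nonneg hT n i) (h.sum_pos hB n).le, ?_⟩
  simp only [share, ← Finset.sum_div]
  exact div_self (h.sum_pos hB n).ne'

theorem noise_succ (h : IsPath R u c₁ c₂) (n : ℕ) (i : Fin d) :
    noise R u (n + 1) i = noise R u n i +
      (R i (c₁ n) (c₂ n) - tensorMap R (share (u n)) (share (u n)) i) := by
  simp only [noise, compensator, h.step n, Finset.sum_range_succ]; ring

theorem abs_noise_succ_sub_le (h : IsPath R u c₁ c₂) (hT : Tenable R) (hB : Balanced R σ) (n : ℕ)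
    (i : Fin d) : |noise R u (n + 1) i - noise R u n i| ≤ σ := by
  have hs := h.share_mem hT hB n
  rw [h.noise_succ, add_sub_cancel_left, abs_le]
  have h1 := hT i (c₁ n) (c₂ n)
  have h2 := le_of_balanced hT hB i (c₁ n) (c₂ n)
  have h3 := tensorMap_nonneg hT hs.1 i
  have h4 := tensorMap_le hT hB hs i
  constructor <;> linarith

/-- The noise starts at 0, so the bound is free of `U 0`; the noise is integrable without any moment
assumption on the initial state. -/
theorem abs_noise_le (h : IsPath R u c₁ c₂) (hT : Tenable R) (hB : Balanced R σ) (n : ℕ)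
    (i : Fin d) : |noise R u n i| ≤ n * σ := by
  induction n with
  | zero => simp [noise, compensator]
  | succ n ih =>
    have h1 := h.abs_noise_succ_sub_le hT hB n i
    have h2 := abs_add_le (noise R u n i) (noise R u (n + 1) i - noise R u n i)
    rw [add_sub_cancel] at h2
    push_cast; linarith

/-- Both vectors compared are nonnegative with the mass of the urn. This crude bound serves only
integrability. -/
theorem drift_le (h : IsPath R u c₁ c₂) (hT : Tenable R) (hB : Balanced R σ) {x : Fin d → ℝ}
    (hx : x ∈ stdSimplex ℝ (Fin d)) (n : ℕ) : drift R x u n ≤ 2 * (∑ i, u 0 i + n * σ) := by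
  have hc : ∀ i, 0 ≤ compensator R u n i := fun i => add_nonneg (h.nonneg_init i)
    (Finset.sum_nonneg fun k _ => tensorMap_nonneg hT (h.share_mem hT hB k).1 i)
  have hsum : ∑ i, compensator R u n i = ∑ i, u 0 i + n * σ := by
    simp only [compensator, Finset.sum_add_distrib]
    rw [Finset.sum_comm]
    simp [fun k => sum_tensorMap hB (h.share_mem hT hB k).2]
  calc drift R x u n ≤ ∑ i, (compensator R u n i + (∑ j, u n j) * x i) := by
        refine Finset.sum_le_sum fun i _ => ?_
        have h1 := hc i
        have h2 := mul_nonneg (h.sum_pos hB n).le (hx.1 i)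
        rw [abs_le]; constructor <;> linarith
    _ = _ := by
        rw [Finset.sum_add_distrib, hsum, ← Finset.mul_sum, hx.2, h.sum_eq hB n]; ring

theorem sum_mul_sum_abs_share_sub_le (h : IsPath R u c₁ c₂) (hB : Balanced R σ) (x : Fin d → ℝ)
    (n : ℕ) : (∑ i, u n i) * ∑ i, |share (u n) i - x i| ≤
      drift R x u n + ∑ i, |noise R u n i| := by
  have hS := h.sum_pos hB n
  rw [Finset.mul_sum, drift, ← Finset.sum_add_distrib]
  refine Finset.sum_le_sum fun i _ => ?_
  calc (∑ i, u n i) * |share (u n) i - x i| = |(∑ i, u n i) * (share (u n) i - x i)| := by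
        rw [abs_mul, abs_of_pos hS]
    _ = |(compensator R u n i - (∑ j, u n j) * x i) + noise R u n i| := by
        rw [mul_sub, share, mul_div_cancel₀ _ hS.ne', noise]; ring_nf
    _ ≤ _ := abs_add_le _ _

theorem sum_abs_share_sub_le (h : IsPath R u c₁ c₂) (hB : Balanced R σ) (x : Fin d → ℝ)
    {n : ℕ} (hn : 1 ≤ n) : ∑ i, |share (u n) i - x i| ≤
      (drift R x u n + ∑ i, |noise R u n i|) / (n * σ) := by
  have hσ := hB.1
  have hn0 : (0 : ℝ) < n := by exact_mod_cast hn
  rw [le_div_iff₀ (by positivity), mul_comm]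
  exact (mul_le_mul_of_nonneg_right (h.mul_le_sum hB n)
    (Finset.sum_nonneg fun _ _ => abs_nonneg _)).trans (h.sum_mul_sum_abs_share_sub_le hB x n)

/-- The compensator grows by `T z` and the target by `σ • x = T x`; contraction bounds the
difference by the distance of the shares from `x`, itself controlled by drift plus noise. -/
theorem drift_succ_le (h : IsPath R u c₁ c₂) (hT : Tenable R) (hB : Balanced R σ) (hr0 : 0 ≤ r)
    (hr : ∀ j j' k k', ∑ i, |R i j k - R i j' k'| ≤ r) {x : Fin d → ℝ}
    (hx : x ∈ stdSimplex ℝ (Fin d)) (hxf : σ • x = tensorMap R x x) {n : ℕ} (hn : 1 ≤ n) :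
    drift R x u (n + 1) ≤
      (1 + r / σ / n) * drift R x u n + r / σ / n * ∑ i, |noise R u n i| := by
  have hσ := hB.1
  have hn0 : (0 : ℝ) < n := by exact_mod_cast hn
  set z := share (u n) with hz
  have hstep : ∀ i, compensator R u (n + 1) i - (∑ j, u (n + 1) j) * x i =
      (compensator R u n i - (∑ j, u n j) * x i) + (tensorMap R z z i - tensorMap R x x i) := by
    intro i
    have h1 : ∑ j, u (n + 1) j = ∑ j, u n j + σ := by
      rw [h.sum_eq hB, h.sum_eq hB n]; push_cast; ring
    simp only [compensator, Finset.sum_range_succ, h1, ← hxf, Pi.smul_apply, smul_eq_mul, hz]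
    ring
  have h1 : drift R x u (n + 1) ≤ drift R x u n + ∑ i, |tensorMap R z z i - tensorMap R x x i| := by
    simp only [drift, hstep, ← Finset.sum_add_distrib]
    exact Finset.sum_le_sum fun i _ => abs_add_le _ _
  have h2 := sum_abs_tensorMap_sub_le hr (h.share_mem hT hB n) hx hr0
  have h3 := mul_le_mul_of_nonneg_left (h.sum_abs_share_sub_le hB x hn) hr0
  refine (h1.trans (add_le_add_right (h2.trans h3) _)).trans_eq ?_
  field_simp
  ring

end IsPath

/-! ### Measurability and moments of the noise -/

variable {Ω : Type*}

theorem measurable_share {m : MeasurableSpace Ω} {U : Ω → Fin d → ℝ} (hU : Measurable U) :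
    Measurable fun ω => share (U ω) := by
  unfold share; fun_prop

theorem measurable_compensator {m : MeasurableSpace Ω} {U : ℕ → Ω → Fin d → ℝ} {n : ℕ}
    (hU : ∀ k ≤ n, Measurable (U k)) (i : Fin d) :
    Measurable fun ω => compensator R (fun k => U k ω) n i := by
  unfold compensator tensorMap
  refine ((measurable_pi_apply i).comp (hU 0 n.zero_le)).add ?_
  refine Finset.measurable_sum _ fun k hk => ?_
  have hs := measurable_share (hU k (Finset.mem_range.1 hk).le)
  fun_prop

theorem measurable_noise {m : MeasurableSpace Ω} {U : ℕ → Ω → Fin d → ℝ} {n : ℕ}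
    (hU : ∀ k ≤ n, Measurable (U k)) (i : Fin d) :
    Measurable fun ω => noise R (fun k => U k ω) n i :=
  ((measurable_pi_apply i).comp (hU n le_rfl)).sub (measurable_compensator hU i)

theorem measurable_drift {m : MeasurableSpace Ω} {U : ℕ → Ω → Fin d → ℝ} {n : ℕ}
    (hU : ∀ k ≤ n, Measurable (U k)) (x : Fin d → ℝ) :
    Measurable fun ω => drift R x (fun k => U k ω) n := by
  have hn := hU n le_rfl
  have hc := fun i => measurable_compensator (R := R) hU i
  unfold drift
  fun_prop

namespace IsTwoDrawUrn

variable [MeasurableSpace Ω] {μ : Measure Ω} {U : ℕ → Ω → Fin d → ℝ}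
  {C₁ C₂ : ℕ → Ω → Fin d}

theorem ae_isPath (h : IsTwoDrawUrn R μ U C₁ C₂) (hpos : ∀ᵐ ω ∂μ, 0 < l1norm (U 0 ω)) :
    ∀ᵐ ω ∂μ, IsPath R (fun n => U n ω) (fun n => C₁ n ω) (fun n => C₂ n ω) := by
  filter_upwards [h.nonneg_init, hpos, ae_all_iff.2 h.step] with ω h0 hp hs
  refine ⟨h0, ?_, hs⟩
  simpa only [l1norm, fun i => abs_of_nonneg (h0 i)] using hp

theorem measurable_natural (h : IsTwoDrawUrn R μ U C₁ C₂) {k n : ℕ} (hk : k ≤ n) :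
    Measurable[Filtration.natural U (fun m => (h.measurable_U m).stronglyMeasurable) n] (U k) :=
  ((Filtration.stronglyAdapted_natural
    (fun m => (h.measurable_U m).stronglyMeasurable) k).measurable).mono
      ((Filtration.natural U (fun m => (h.measurable_U m).stronglyMeasurable)).mono hk) le_rfl

/-- Pull the factor known at time `n` out of the conditional expectation; the draw law applies
because the mass is almost surely positive. -/
theorem integral_mul_indicator [IsFiniteMeasure μ] (h : IsTwoDrawUrn R μ U C₁ C₂)
    (hB : Balanced R σ) (hpos : ∀ᵐ ω ∂μ, 0 < l1norm (U 0 ω)) (n : ℕ) (j k : Fin d) {g : Ω → ℝ}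
    (hg : Measurable[Filtration.natural U (fun m => (h.measurable_U m).stronglyMeasurable) n] g)
    (c : ℝ) (hgc : ∀ᵐ ω ∂μ, |g ω| ≤ c) :
    ∫ ω, g ω * {ω' | C₁ n ω' = j ∧ C₂ n ω' = k}.indicator (fun _ => (1 : ℝ)) ω ∂μ =
      ∫ ω, g ω * (share (U n ω) j * share (U n ω) k) ∂μ := by
  set F := Filtration.natural U (fun m => (h.measurable_U m).stronglyMeasurable)
  set s := {ω' | C₁ n ω' = j ∧ C₂ n ω' = k}
  have hs : MeasurableSet s :=
    (h.measurable_C₁ n (measurableSet_singleton j)).inter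
      (h.measurable_C₂ n (measurableSet_singleton k))
  have hint : Integrable (s.indicator fun _ => (1 : ℝ)) μ := (integrable_const 1).indicator hs
  have h1 := condExp_stronglyMeasurable_mul_of_bound (F.le n) hg.stronglyMeasurable hint c hgc
  have h2 := integral_condExp (μ := μ) (F.le n) (f := g * s.indicator fun _ => (1 : ℝ))
  simp only [Pi.mul_apply] at h2
  rw [← h2]
  refine integral_congr_ae ?_
  filter_upwards [h1, h.draw n j k, h.ae_isPath hpos] with ω h3 h4 h5
  rw [h3, Pi.mul_apply]
  exact congrArg _ (h4 (h5.sum_pos hB n))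

theorem integral_noise_mul_sub [IsFiniteMeasure μ] (h : IsTwoDrawUrn R μ U C₁ C₂)
    (hT : Tenable R) (hB : Balanced R σ) (hpos : ∀ᵐ ω ∂μ, 0 < l1norm (U 0 ω)) (n : ℕ)
    (i : Fin d) :
    ∫ ω, noise R (fun k => U k ω) n i *
      (noise R (fun k => U k ω) (n + 1) i - noise R (fun k => U k ω) n i) ∂μ = 0 := by
  have hpath := h.ae_isPath hpos
  set g : Ω → ℝ := fun ω => noise R (fun k => U k ω) n i with hg
  have hgm := measurable_noise (R := R) (n := n) (fun k hk => h.measurable_natural hk) i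
  have hgm' : Measurable g := measurable_noise (fun k _ => h.measurable_U k) i
  have hgc : ∀ᵐ ω ∂μ, |g ω| ≤ n * σ := by
    filter_upwards [hpath] with ω hω using hω.abs_noise_le hT hB n i
  set I : Fin d → Fin d → Ω → ℝ := fun j k =>
    {ω' | C₁ n ω' = j ∧ C₂ n ω' = k}.indicator (fun _ => (1 : ℝ)) with hI
  have hs := fun j k => (h.measurable_C₁ n (measurableSet_singleton j)).inter
      (h.measurable_C₂ n (measurableSet_singleton k))
  have hI1 : ∀ j k, Integrable (fun ω => g ω * I j k ω) μ := by
    intro j k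
    refine Integrable.of_bound (hgm'.mul (measurable_const.indicator (hs j k))).aestronglyMeasurable
      (n * σ) ?_
    filter_upwards [hgc] with ω hω
    rw [Real.norm_eq_abs, abs_mul]
    refine (mul_le_of_le_one_right (abs_nonneg _) ?_).trans hω
    by_cases hmem : C₁ n ω = j ∧ C₂ n ω = k <;> simp [hI, hmem]
  have hI2 : ∀ j k, Integrable (fun ω => g ω * (share (U n ω) j * share (U n ω) k)) μ := by
    intro j k
    have hsh := measurable_share (h.measurable_U n)
    refine Integrable.of_bound (by fun_prop) (n * σ) ?_
    filter_upwards [hgc, hpath] with ω hω hp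
    have hz := hp.share_mem hT hB n
    rw [Real.norm_eq_abs, abs_mul, abs_mul, abs_of_nonneg (hz.1 j), abs_of_nonneg (hz.1 k)]
    exact (mul_le_of_le_one_right (abs_nonneg _) (mul_le_one₀ (mem_Icc_of_mem_stdSimplex hz j).2
      (hz.1 k) (mem_Icc_of_mem_stdSimplex hz k).2)).trans hω
  -- Expanding over the possible colour pairs reduces the martingale property to the conditional law
  -- of the two draws.
  have hdecomp : (fun ω => g ω * (noise R (fun k => U k ω) (n + 1) i - g ω)) =ᵐ[μ]
      fun ω => ∑ j, ∑ k, R i j k *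
        (g ω * I j k ω - g ω * (share (U n ω) j * share (U n ω) k)) := by
    filter_upwards [hpath] with ω hω
    have hR : R i (C₁ n ω) (C₂ n ω) = ∑ j, ∑ k, R i j k * I j k ω := by
      rw [Finset.sum_eq_single (C₁ n ω), Finset.sum_eq_single (C₂ n ω)]
      · simp [hI]
      · intro k _ hk; simp [hI, hk.symm]
      · simp
      · intro j _ hj; simp [hI, hj.symm]
      · simp
    simp only [hg, hω.noise_succ, add_sub_cancel_left, hR, tensorMap, ← Finset.sum_sub_distrib,
      Finset.mul_sum]
    refine Finset.sum_congr rfl fun j _ => Finset.sum_congr rfl fun k _ => by ring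
  rw [integral_congr_ae hdecomp]
  have hI3 : ∀ j k, Integrable (fun ω => R i j k *
      (g ω * I j k ω - g ω * (share (U n ω) j * share (U n ω) k))) μ :=
    fun j k => ((hI1 j k).sub (hI2 j k)).const_mul (R i j k)
  rw [integral_finsetSum _ fun j _ => integrable_finsetSum _ fun k _ => hI3 j k]
  refine Finset.sum_eq_zero fun j _ => ?_
  rw [integral_finsetSum _ fun k _ => hI3 j k]
  refine Finset.sum_eq_zero fun k _ => ?_
  rw [integral_const_mul, integral_sub (hI1 j k) (hI2 j k),
    h.integral_mul_indicator hB hpos n j k hgm _ hgc, sub_self, mul_zero]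

theorem integrable_noise [IsFiniteMeasure μ] (h : IsTwoDrawUrn R μ U C₁ C₂)
    (hT : Tenable R) (hB : Balanced R σ) (hpos : ∀ᵐ ω ∂μ, 0 < l1norm (U 0 ω)) (n : ℕ)
    (i : Fin d) : Integrable (fun ω => noise R (fun k => U k ω) n i) μ :=
  Integrable.of_bound (measurable_noise (fun k _ => h.measurable_U k) i).aestronglyMeasurable
    (n * σ) (by filter_upwards [h.ae_isPath hpos] with ω hω using hω.abs_noise_le hT hB n i)

theorem integrable_noise_mul [IsFiniteMeasure μ] (h : IsTwoDrawUrn R μ U C₁ C₂)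
    (hT : Tenable R) (hB : Balanced R σ) (hpos : ∀ᵐ ω ∂μ, 0 < l1norm (U 0 ω)) (m n : ℕ)
    (i : Fin d) :
    Integrable (fun ω => noise R (fun k => U k ω) m i * noise R (fun k => U k ω) n i) μ :=
  (h.integrable_noise hT hB hpos n i).bdd_mul (c := m * σ)
    (measurable_noise (fun k _ => h.measurable_U k) i).aestronglyMeasurable
    (by filter_upwards [h.ae_isPath hpos] with ω hω using hω.abs_noise_le hT hB m i)

/-- Orthogonality kills the cross term, and each increment contributes at most `σ ^ 2`. -/
theorem integral_noise_sq_le [IsProbabilityMeasure μ] (h : IsTwoDrawUrn R μ U C₁ C₂)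
    (hT : Tenable R) (hB : Balanced R σ) (hpos : ∀ᵐ ω ∂μ, 0 < l1norm (U 0 ω)) (n : ℕ)
    (i : Fin d) : ∫ ω, noise R (fun k => U k ω) n i ^ 2 ∂μ ≤ n * σ ^ 2 := by
  induction n with
  | zero => simp [noise, compensator]
  | succ n ih =>
    have h1 := h.integral_noise_mul_sub hT hB hpos n i
    have hsq : ∀ n, Integrable (fun ω => noise R (fun k => U k ω) n i ^ 2) μ := fun n => by
      simpa only [sq] using h.integrable_noise_mul hT hB hpos n n i
    have hcross : Integrable (fun ω => noise R (fun k => U k ω) n i *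
        (noise R (fun k => U k ω) (n + 1) i - noise R (fun k => U k ω) n i)) μ := by
      simp only [mul_sub]
      exact (h.integrable_noise_mul hT hB hpos n (n + 1) i).sub
        (h.integrable_noise_mul hT hB hpos n n i)
    have hadd : Integrable (fun ω => noise R (fun k => U k ω) n i ^ 2 +
        2 * (noise R (fun k => U k ω) n i *
          (noise R (fun k => U k ω) (n + 1) i - noise R (fun k => U k ω) n i))) μ :=
      (hsq n).add (hcross.const_mul 2)
    calc ∫ ω, noise R (fun k => U k ω) (n + 1) i ^ 2 ∂μ
        ≤ ∫ ω, ((noise R (fun k => U k ω) n i ^ 2 + 2 * (noise R (fun k => U k ω) n i *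
          (noise R (fun k => U k ω) (n + 1) i - noise R (fun k => U k ω) n i))) + σ ^ 2) ∂μ := by
          refine integral_mono_ae (hsq _)
            (hadd.add (integrable_const _)) ?_
          filter_upwards [h.ae_isPath hpos] with ω hω
          have := hω.abs_noise_succ_sub_le hT hB n i
          have := sq_le_sq' (abs_le.1 this).1 (abs_le.1 this).2
          nlinarith
      _ = ∫ ω, noise R (fun k => U k ω) n i ^ 2 ∂μ + σ ^ 2 := by
          rw [integral_add hadd (integrable_const _),
            integral_add (hsq n) (hcross.const_mul 2), integral_const_mul, h1]
          simp
      _ ≤ _ := by push_cast; linarith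

theorem integral_abs_noise_le [IsProbabilityMeasure μ] (h : IsTwoDrawUrn R μ U C₁ C₂)
    (hT : Tenable R) (hB : Balanced R σ) (hpos : ∀ᵐ ω ∂μ, 0 < l1norm (U 0 ω)) {n : ℕ}
    (hn : 1 ≤ n) (i : Fin d) :
    ∫ ω, |noise R (fun k => U k ω) n i| ∂μ ≤ (σ ^ 2 + 1) / 2 * √(n : ℝ) := by
  have hn0 : (0 : ℝ) < n := by exact_mod_cast hn
  have hs : 0 < √(n : ℝ) := Real.sqrt_pos.2 hn0
  have hss : √(n : ℝ) ^ 2 = n := Real.sq_sqrt hn0.le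
  have hsq : Integrable (fun ω => noise R (fun k => U k ω) n i ^ 2) μ := by
    simpa only [sq] using h.integrable_noise_mul hT hB hpos n n i
  -- AM-GM with weight `√n`, in place of Cauchy–Schwarz.
  calc ∫ ω, |noise R (fun k => U k ω) n i| ∂μ
      ≤ ∫ ω, (noise R (fun k => U k ω) n i ^ 2 / (2 * √(n : ℝ)) + √(n : ℝ) / 2) ∂μ := by
        refine integral_mono (h.integrable_noise hT hB hpos n i).abs
          ((hsq.div_const _).add (integrable_const _)) fun ω => ?_
        simp only
        rw [div_add_div _ _ (by positivity) two_ne_zero, le_div_iff₀ (by positivity)]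
        nlinarith [sq_nonneg (|noise R (fun k => U k ω) n i| - √(n : ℝ)),
          sq_abs (noise R (fun k => U k ω) n i)]
    _ = (∫ ω, noise R (fun k => U k ω) n i ^ 2 ∂μ) / (2 * √(n : ℝ)) + √(n : ℝ) / 2 := by
        rw [integral_add (hsq.div_const _) (integrable_const _), integral_div]; simp
    _ ≤ n * σ ^ 2 / (2 * √(n : ℝ)) + √(n : ℝ) / 2 := by
        gcongr; exact h.integral_noise_sq_le hT hB hpos n i
    _ = _ := by
        have h3 : n * σ ^ 2 / (2 * √(n : ℝ)) = σ ^ 2 / 2 * √(n : ℝ) := by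
          rw [div_eq_iff (by positivity)]
          linear_combination (-σ ^ 2) * hss
        rw [h3]; ring

theorem integral_sum_abs_noise_le [IsProbabilityMeasure μ] (h : IsTwoDrawUrn R μ U C₁ C₂)
    (hT : Tenable R) (hB : Balanced R σ) (hpos : ∀ᵐ ω ∂μ, 0 < l1norm (U 0 ω)) {n : ℕ}
    (hn : 1 ≤ n) :
    ∫ ω, ∑ i, |noise R (fun k => U k ω) n i| ∂μ ≤ d * ((σ ^ 2 + 1) / 2) * √(n : ℝ) := by
  rw [integral_finsetSum _ fun i _ => (h.integrable_noise hT hB hpos n i).abs]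
  refine (Finset.sum_le_sum fun i _ => h.integral_abs_noise_le hT hB hpos hn i).trans_eq ?_
  simp [mul_assoc]

/-! ### Convergence in probability -/

/-- On the event that the initial mass is bounded, the drift is `o(n)` in `L¹`. -/
theorem tendsto_setIntegral_drift [IsProbabilityMeasure μ] (h : IsTwoDrawUrn R μ U C₁ C₂)
    (hT : Tenable R) (hB : Balanced R σ) (hpos : ∀ᵐ ω ∂μ, 0 < l1norm (U 0 ω)) (hr0 : 0 ≤ r)
    (hrσ : r < σ) (hr : ∀ j j' k k', ∑ i, |R i j k - R i j' k'| ≤ r) {x : Fin d → ℝ}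
    (hx : x ∈ stdSimplex ℝ (Fin d)) (hxf : σ • x = tensorMap R x x) {A : Set Ω}
    (hA : MeasurableSet A) {K : ℝ} (hK : ∀ ω ∈ A, ∑ i, U 0 ω i ≤ K) :
    (∀ n, IntegrableOn (fun ω => drift R x (fun k => U k ω) n) A μ) ∧
    Tendsto (fun n : ℕ => (∫ ω in A, drift R x (fun k => U k ω) n ∂μ) / n) atTop (nhds 0) := by
  have hσ := hB.1
  have hpath : ∀ᵐ ω ∂μ.restrict A, _ := ae_restrict_of_ae (h.ae_isPath hpos)
  have hmem : ∀ᵐ ω ∂μ.restrict A, ω ∈ A := ae_restrict_mem hA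
  have hd0 : ∀ n ω, 0 ≤ drift R x (fun k => U k ω) n :=
    fun n ω => Finset.sum_nonneg fun _ _ => abs_nonneg _
  have hint : ∀ n, IntegrableOn (fun ω => drift R x (fun k => U k ω) n) A μ := by
    intro n
    refine Integrable.of_bound
      (measurable_drift (fun k _ => h.measurable_U k) x).aestronglyMeasurable
      (2 * (K + n * σ)) ?_
    filter_upwards [hpath, hmem] with ω hω hωA
    rw [Real.norm_eq_abs, abs_of_nonneg (hd0 n ω)]
    linarith [hω.drift_le hT hB hx n, hK ω hωA]
  have hnoise : ∀ n, Integrable (fun ω => ∑ i, |noise R (fun k => U k ω) n i|) μ :=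
    fun n => integrable_finsetSum _ fun i _ => (h.integrable_noise hT hB hpos n i).abs
  refine ⟨hint, tendsto_div_atTop_of_le (κ := r / σ) (C := r / σ * (d * ((σ ^ 2 + 1) / 2)))
    (fun n => integral_nonneg (hd0 n)) (div_nonneg hr0 hσ.le) ((div_lt_one hσ).2 hrσ)
    fun n hn => ?_⟩
  have hn0 : (0 : ℝ) < n := by exact_mod_cast hn
  calc ∫ ω in A, drift R x (fun k => U k ω) (n + 1) ∂μ
      ≤ ∫ ω in A, ((1 + r / σ / n) * drift R x (fun k => U k ω) n +
          r / σ / n * ∑ i, |noise R (fun k => U k ω) n i|) ∂μ := by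
        refine integral_mono_ae (hint _)
          (((hint n).const_mul _).add ((hnoise n).integrableOn.const_mul _)) ?_
        filter_upwards [hpath] with ω hω using hω.drift_succ_le hT hB hr0 hr hx hxf hn
    _ = (1 + r / σ / n) * ∫ ω in A, drift R x (fun k => U k ω) n ∂μ +
          r / σ / n * ∫ ω in A, ∑ i, |noise R (fun k => U k ω) n i| ∂μ := by
        rw [integral_add ((hint n).const_mul _) ((hnoise n).integrableOn.const_mul _),
          integral_const_mul, integral_const_mul]
    _ ≤ (1 + r / σ / n) * ∫ ω in A, drift R x (fun k => U k ω) n ∂μ +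
          r / σ / n * (d * ((σ ^ 2 + 1) / 2) * √(n : ℝ)) := by
        gcongr
        exact (setIntegral_le_integral (hnoise n) (ae_of_all _ fun ω =>
          Finset.sum_nonneg fun _ _ => abs_nonneg _)).trans
            (h.integral_sum_abs_noise_le hT hB hpos hn)
    _ = _ := by ring

theorem tendstoInMeasure [IsProbabilityMeasure μ] (h : IsTwoDrawUrn R μ U C₁ C₂)
    (hT : Tenable R) (hB : Balanced R σ) (hpos : ∀ᵐ ω ∂μ, 0 < l1norm (U 0 ω)) (hr0 : 0 ≤ r)
    (hrσ : r < σ) (hr : ∀ j j' k k', ∑ i, |R i j k - R i j' k'| ≤ r) {x : Fin d → ℝ}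
    (hx : x ∈ stdSimplex ℝ (Fin d)) (hxf : σ • x = tensorMap R x x) :
    TendstoInMeasure μ (fun n ω => (l1norm (U n ω))⁻¹ • U n ω) atTop (fun _ => x) := by
  have hσ := hB.1
  have hpath := h.ae_isPath hpos
  rw [tendstoInMeasure_iff_measureReal_norm]
  intro ε hε
  -- Discard the event of initial mass above `K`, whose probability vanishes as `K → ∞`; half of `η`
  -- pays for it, the other half for Markov's inequality on the complement.
  set B : ℕ → Set Ω := fun K => {ω | (K : ℝ) < ∑ i, U 0 ω i} with hBdef
  have hm0 := h.measurable_U 0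
  have hBm : ∀ K, MeasurableSet (B K) := fun K => measurableSet_lt measurable_const (by fun_prop)
  have hBlim : Tendsto (fun K => μ.real (B K)) atTop (nhds 0) := by
    have hempty : ⋂ K, B K = ∅ := by
      refine Set.eq_empty_of_forall_notMem fun ω hω => ?_
      obtain ⟨K, hK⟩ := exists_nat_ge (∑ i, U 0 ω i)
      exact absurd (Set.mem_iInter.1 hω K) (not_lt.2 hK)
    have := tendsto_measure_iInter_atTop (μ := μ) (fun K => (hBm K).nullMeasurableSet)
      (fun K L hKL ω (hω : (L : ℝ) < _) => lt_of_le_of_lt (by exact_mod_cast hKL) hω)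
      ⟨0, measure_ne_top _ _⟩
    rw [hempty, measure_empty] at this
    exact (ENNReal.tendsto_toReal ENNReal.zero_ne_top).comp this
  refine Metric.tendsto_atTop.2 fun η hη => ?_
  obtain ⟨K, hK⟩ := (hBlim.eventually (gt_mem_nhds (half_pos hη))).exists
  obtain ⟨hint, hlim⟩ := h.tendsto_setIntegral_drift hT hB hpos hr0 hrσ hr hx hxf
    (hBm K).compl (K := K) (fun ω hω => not_lt.1 hω)
  have hnoise : ∀ n, Integrable (fun ω => ∑ i, |noise R (fun k => U k ω) n i|) μ :=
    fun n => integrable_finsetSum _ fun i _ => (h.integrable_noise hT hB hpos n i).abs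
  have hinv : Tendsto (fun n : ℕ => (d : ℝ) * ((σ ^ 2 + 1) / 2) * (√(n : ℝ))⁻¹) atTop (nhds 0) := by
    simpa using (tendsto_inv_atTop_zero.comp
      (Real.tendsto_sqrt_atTop.comp tendsto_natCast_atTop_atTop)).const_mul
        ((d : ℝ) * ((σ ^ 2 + 1) / 2))
  have hsum := hlim.add hinv
  rw [add_zero] at hsum
  obtain ⟨N, hN⟩ := eventually_atTop.1
    (hsum.eventually (gt_mem_nhds (show 0 < η / 2 * (ε * σ) by positivity)))
  refine ⟨max N 1, fun n hn => ?_⟩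
  have hn1 : 1 ≤ n := (le_max_right _ _).trans hn
  have hn0 : (0 : ℝ) < n := by exact_mod_cast hn1
  have hs : 0 < √(n : ℝ) := Real.sqrt_pos.2 hn0
  rw [Real.dist_eq, sub_zero, abs_of_nonneg measureReal_nonneg]
  set f : Ω → ℝ := fun ω => drift R x (fun k => U k ω) n + ∑ i, |noise R (fun k => U k ω) n i|
    with hf
  have hf0 : ∀ ω, 0 ≤ f ω := fun ω => add_nonneg (Finset.sum_nonneg fun _ _ => abs_nonneg _)
    (Finset.sum_nonneg fun _ _ => abs_nonneg _)
  have hfint : IntegrableOn f (B K)ᶜ μ := (hint n).add (hnoise n).integrableOn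
  have hmarkov := mul_meas_ge_le_integral_of_nonneg (ae_of_all _ hf0) hfint (ε * (n * σ))
  have hfle : ∫ ω in (B K)ᶜ, f ω ∂μ < η / 2 * (ε * σ) * n := by
    have h1 := hN n ((le_max_left _ _).trans hn)
    have h2 : ∫ ω in (B K)ᶜ, ∑ i, |noise R (fun k => U k ω) n i| ∂μ ≤
        d * ((σ ^ 2 + 1) / 2) * √(n : ℝ) :=
      (setIntegral_le_integral (hnoise n) (ae_of_all _ fun ω =>
          Finset.sum_nonneg fun _ _ => abs_nonneg _)).trans
            (h.integral_sum_abs_noise_le hT hB hpos hn1)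
    rw [hf, integral_add (hint n) (hnoise n).integrableOn]
    have h3 : √(n : ℝ) = (√(n : ℝ))⁻¹ * n := by
      rw [inv_mul_eq_div, eq_div_iff hs.ne', Real.mul_self_sqrt hn0.le]
    rw [h3] at h2
    have h4 := mul_lt_mul_of_pos_right h1 hn0
    rw [add_mul, div_mul_cancel₀ _ hn0.ne'] at h4
    linarith
  have hreal : (μ.restrict (B K)ᶜ).real {ω | ε * (n * σ) ≤ f ω} < η / 2 := by
    have : ε * (n * σ) * (μ.restrict (B K)ᶜ).real {ω | ε * (n * σ) ≤ f ω} <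
      ε * (n * σ) * (η / 2) := by
      calc _ ≤ _ := hmarkov
        _ < _ := hfle
        _ = _ := by ring
    exact lt_of_mul_lt_mul_left this (by positivity)
  -- The norm here is the sup norm, dominated by the `ℓ¹`-distance, which is at most `f ω / (n *
  -- σ)`.
  have hsub : {ω | ε ≤ ‖(l1norm (U n ω))⁻¹ • U n ω - x‖} ≤ᵐ[μ]
      (B K ∪ ({ω | ε * (n * σ) ≤ f ω} ∩ (B K)ᶜ) : Set Ω) := by
    filter_upwards [hpath] with ω hω hmem
    by_cases hωB : ω ∈ B K
    · exact Or.inl hωB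
    refine Or.inr ⟨?_, hωB⟩
    have hmem' : ε ≤ ‖(l1norm (U n ω))⁻¹ • U n ω - x‖ := hmem
    have heq : (l1norm (U n ω))⁻¹ • U n ω = share (U n ω) := by
      funext i
      simp only [l1norm, fun i => abs_of_nonneg (hω.nonneg hT n i), share, Pi.smul_apply,
        smul_eq_mul, inv_mul_eq_div]
    have hle : ‖share (U n ω) - x‖ ≤ ∑ i, |share (U n ω) i - x i| :=
      (pi_norm_le_iff_of_nonneg (Finset.sum_nonneg fun _ _ => abs_nonneg _)).2 fun i =>
        Finset.single_le_sum (f := fun i => |share (U n ω) i - x i|)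
          (fun _ _ => abs_nonneg _) (Finset.mem_univ i)
    rw [heq] at hmem'
    exact (le_div_iff₀ (by positivity)).1
      ((hmem'.trans hle).trans (hω.sum_abs_share_sub_le hB x hn1))
  have hmeas : μ.real {ω | ε ≤ ‖(l1norm (U n ω))⁻¹ • U n ω - x‖} ≤
      μ.real (B K ∪ ({ω | ε * (n * σ) ≤ f ω} ∩ (B K)ᶜ)) :=
    ENNReal.toReal_mono (measure_ne_top _ _) (measure_mono_ae hsub)
  have hunion := measureReal_union_le (μ := μ) (B K) ({ω | ε * (n * σ) ≤ f ω} ∩ (B K)ᶜ)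
  rw [← measureReal_restrict_apply' (hBm K).compl] at hunion
  linarith

end IsTwoDrawUrn

end PolyaUrn

theorem theorem1 {d : ℕ} (hd : 1 ≤ d) (R : Fin d → Fin d → Fin d → ℝ) (σ : ℝ)
    (hT : PolyaUrn.Tenable R) (hB : PolyaUrn.Balanced R σ) (hE : PolyaUrn.Ergodic R σ) :
    ∃ x : Fin d → ℝ,
      (x ∈ stdSimplex ℝ (Fin d) ∧ σ • x = PolyaUrn.tensorMap R x x) ∧
      (∀ y ∈ stdSimplex ℝ (Fin d), σ • y = PolyaUrn.tensorMap R y y → y = x) ∧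
      ∀ (Ω : Type*) [MeasurableSpace Ω] (μ : Measure Ω) [IsProbabilityMeasure μ]
        (U : ℕ → Ω → Fin d → ℝ) (C₁ C₂ : ℕ → Ω → Fin d),
        PolyaUrn.IsTwoDrawUrn R μ U C₁ C₂ →
        (∀ᵐ ω ∂μ, 0 < PolyaUrn.l1norm (U 0 ω)) →
        TendstoInMeasure μ (fun n ω => (PolyaUrn.l1norm (U n ω))⁻¹ • U n ω) atTop
          (fun _ => x) := by
  obtain ⟨r, hr0, hrσ, hr⟩ := PolyaUrn.Ergodic.exists_lt hE hB.1
  obtain ⟨x, hx, hxf⟩ := PolyaUrn.exists_fixed hd hT hB hr0 hrσ hr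
  refine ⟨x, ⟨hx, hxf⟩, fun y hy hyf => PolyaUrn.eq_of_fixed hr0 hrσ hr hx hy hxf hyf, ?_⟩
  intro Ω _ μ _ U C₁ C₂ hU hpos
  exact hU.tendstoInMeasure hT hB hpos hr0 hrσ hr hx hxf
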